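/- Consider the Markovian jump linear system $x_{k+1}=A_{\theta_k}x_k+B_{\theta_k}u_k$, $y_k=C_{\theta_k}x_k$, with $x_k\in\mathbb{R}^n$, $u_k\in\mathbb{R}^m$, $y_k\in\mathbb{R}^q$, where $(\theta_k)_{k\ge 0}$ is a homogeneous Markov chain on $\Theta=\{1,\dots,N\}$ with transition probabilities $p_{ij}$. Let $I_k=(x_k,\theta_k)$, and let $Q_i\ge 0$ and $R_i>0$ ($i\in\Theta$) be symmetric weighting matrices. A control policy chooses $u_k$ as a function of $I_0,\dots,I_k$. Its cost is $$J(x_0,\theta_0)=\mathbb{E}\Big[\sum_{k=0}^\infty \big(x_k^TQ_{\theta_k}x_k+u_k^TR_{\theta_k}u_k\big)\,\Big|\,I_0\Big]\in[0,\infty],$$ and the optimal value function $J^*(x,i)$ is the infimum of the cost over all control policies, for $I_0=(x,i)$. A feedback $u_k=\mu(x_k,\theta_k)$ is called optimal if its cost equals $J^*(x,i)$ for every initial condition $(x,i)\in\mathbb{R}^n\times\Theta$. Assume: 1. (conditional independence) under every control policy and for every initial condition, $\mathbb{E}[f(x_{k+1})g(\theta_{k+1})\mid I_k]=\mathbb{E}[f(x_{k+1})\mid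 I_k]\,\mathbb{E}[g(\theta_{k+1})\mid I_k]$ almost surely, for all $k\ge0$ and all bounded measurable $f$ and $g$; 2. (ergodicity) for all $i,j\in\Theta$, the chain started at $i$ reaches $j$ within a finite number of steps with non-zero probability; 3. (mean-square stabilizability) there are $K_1,\dots,K_N\in\mathbb{R}^{m\times n}$ such that under $u_k=-K_{\theta_k}x_k$ one has $\sum_{k=0}^\infty\mathbb{E}[\|x_k\|^2\mid I_0]<\infty$ for every $I_0\in\mathbb{R}^n\times\Theta$. For $V:\mathbb{R}^n\times\Theta\to\mathbb{R}$ put $$\mathcal{Q}_V(x,i,u)=x^TQ_ix+u^TR_iu+\mathbb{E}\big[V(A_ix+B_iu,\theta_{k+1})\mid\theta_k=i\big].$$ Value iteration starts from $J^0=0$ and sets, for $j\ge 0$, $$u^j(x,i)\in\arg\min_{u}\mathcal{Q}_{J^j}(x,i,u),\qquad J^{j+1}(x,i)=\mathcal{Q}_{J^j}\big(x,i,u^j(x,i)\big).$$ Then sequences $(J^j)$, $(u^j)$ of this kind exist, and for all such sequences the following hold. * For every $(x,i)\in\mathbb{R}^n\times\Theta$, the sequence $(J^j(x,i))_{j\ge0}$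 is non-negative, non-decreasing and bounded; hence $J^\infty(x,i)=\lim_{j\to\infty}J^j(x,i)$ exists. * $J^\infty=J^*$; in particular $J^*$ is finite. * $J^\infty$ satisfies the HJB equation $J^\infty(x,i)=\min_u\mathcal{Q}_{J^\infty}(x,i,u)$ for all $(x,i)$, the minimum being attained. * An optimal feedback exists, and a feedback $\mu$ is optimal if and only if $\mu(x,i)\in\arg\min_u\mathcal{Q}_{J^\infty}(x,i,u)$ for all $(x,i)$. * For every optimal feedback $u^*$, $J^\infty$ satisfies the Bellman equation: $J^\infty(x,i)=\mathcal{Q}_{J^\infty}(x,i,u^*(x,i))$ for all $(x,i)$, and along the closed-loop trajectory with $u_k=u^*(x_k,\theta_k)$ from any initial condition, for all $k\ge0$, almost surely $$J^\infty(x_k,\theta_k)=x_k^TQ_{\theta_k}x_k+u_k^TR_{\theta_k}u_k+\mathbb{E}[J^\infty(x_{k+1},\theta_{k+1})\mid I_k].$$ -/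

import Mathlib

open MeasureTheory

noncomputable section

/-- The data of a discrete-time Markovian jump linear system
`x (k+1) = A_{θ k} x k + B_{θ k} u k`, `y k = C_{θ k} x k`, with `N` modes, mode transition
probabilities `trans i j`, and the weights `Q i ≥ 0`, `R i > 0` of the quadratic cost. -/
structure MJLS (n m q N : ℕ) where
  A : Fin N → Matrix (Fin n) (Fin n) ℝ
  B : Fin N → Matrix (Fin n) (Fin m) ℝ
  C : Fin N → Matrix (Fin q) (Fin n) ℝ
  trans : Matrix (Fin N) (Fin N) ℝ
  trans_nonneg : ∀ i j, 0 ≤ trans i j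
  trans_sum : ∀ i, ∑ j, trans i j = 1
  Q : Fin N → Matrix (Fin n) (Fin n) ℝ
  R : Fin N → Matrix (Fin m) (Fin m) ℝ
  Q_posSemidef : ∀ i, (Q i).PosSemidef
  R_posDef : ∀ i, (R i).PosDef

/-- `θ` is, under each `ℙ i`, a homogeneous Markov chain started at the mode `i` with transition
matrix `p`. So `ℙ i` is the conditional law given `θ 0 = i`. The Markov property
`P[θ (k+1) = s (k+1) | θ 0 = s 0, …, θ k = s k] = p (s k) (s (k+1))` is written without
division. -/
structure IsModeChain {N : ℕ} (p : Matrix (Fin N) (Fin N) ℝ) {Ω : Type*} [MeasurableSpace Ω]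
    (ℙ : Fin N → Measure Ω) (θ : ℕ → Ω → Fin N) : Prop where
  prob : ∀ i, IsProbabilityMeasure (ℙ i)
  meas : ∀ k, Measurable (θ k)
  init : ∀ i, ∀ᵐ ω ∂(ℙ i), θ 0 ω = i
  markov : ∀ (i : Fin N) (k : ℕ) (s : ℕ → Fin N),
    ℙ i {ω | ∀ l ≤ k + 1, θ l ω = s l} =
      ℙ i {ω | ∀ l ≤ k, θ l ω = s l} * ENNReal.ofReal (p (s k) (s (k + 1)))

/-- A causal control policy: the input at time `k` is a function of the information
`(x 0, θ 0), …, (x k, θ k)`. As the initial state is fixed and there are finitely many modes, this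
information takes finitely many values, so no measurability has to be imposed. -/
abbrev ControlPolicy (n m N : ℕ) : Type :=
  (k : ℕ) → (Fin (k + 1) → (Fin n → ℝ) × Fin N) → (Fin m → ℝ)

/-- The policy of a stationary state-and-mode feedback `u k = μ (x k) (θ k)`. -/
def feedbackPolicy {n m N : ℕ} (μ : (Fin n → ℝ) → Fin N → (Fin m → ℝ)) : ControlPolicy n m N :=
  fun k h => μ (h (Fin.last k)).1 (h (Fin.last k)).2

namespace MJLS

variable {n m q N : ℕ} (S : MJLS n m q N)

/-- The information `(x 0, θ 0), …, (x k, θ k)` generated by the policy `π` from the initial state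
`x₀` along the mode path `s`. -/
def history (π : ControlPolicy n m N) (x₀ : Fin n → ℝ) (s : ℕ → Fin N) :
    (k : ℕ) → (Fin (k + 1) → (Fin n → ℝ) × Fin N)
  | 0 => fun _ => (x₀, s 0)
  | k + 1 =>
    let h := history π x₀ s k
    Fin.snoc (α := fun _ => (Fin n → ℝ) × Fin N) h
      ((S.A (s k)).mulVec (h (Fin.last k)).1 + (S.B (s k)).mulVec (π k h), s (k + 1))

/-- The state `x k`. -/
def state (π : ControlPolicy n m N) (x₀ : Fin n → ℝ) (s : ℕ → Fin N) (k : ℕ) : Fin n → ℝ :=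
  (S.history π x₀ s k (Fin.last k)).1

/-- The input `u k`. -/
def input (π : ControlPolicy n m N) (x₀ : Fin n → ℝ) (s : ℕ → Fin N) (k : ℕ) : Fin m → ℝ :=
  π k (S.history π x₀ s k)

theorem state_zero (π : ControlPolicy n m N) (x₀ : Fin n → ℝ) (s : ℕ → Fin N) :
    S.state π x₀ s 0 = x₀ := rfl

theorem state_succ (π : ControlPolicy n m N) (x₀ : Fin n → ℝ) (s : ℕ → Fin N) (k : ℕ) :
    S.state π x₀ s (k + 1) =
      (S.A (s k)).mulVec (S.state π x₀ s k) + (S.B (s k)).mulVec (S.input π x₀ s k) := by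
  simp [state, input, history]

theorem history_last (π : ControlPolicy n m N) (x₀ : Fin n → ℝ) (s : ℕ → Fin N) (k : ℕ) :
    S.history π x₀ s k (Fin.last k) = (S.state π x₀ s k, s k) := by
  cases k <;> simp [state, history]

theorem input_feedback (μ : (Fin n → ℝ) → Fin N → (Fin m → ℝ)) (x₀ : Fin n → ℝ)
    (s : ℕ → Fin N) (k : ℕ) :
    S.input (feedbackPolicy μ) x₀ s k = μ (S.state (feedbackPolicy μ) x₀ s k) (s k) := by
  simp [input, feedbackPolicy, history_last]

/-- The stage cost `xᵀ Q_i x + uᵀ R_i u`. -/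
def stageCost (x : Fin n → ℝ) (i : Fin N) (u : Fin m → ℝ) : ℝ :=
  x ⬝ᵥ (S.Q i).mulVec x + u ⬝ᵥ (S.R i).mulVec u

variable {Ω : Type*} [MeasurableSpace Ω] (ℙ : Fin N → Measure Ω) (θ : ℕ → Ω → Fin N)

/-- The overall state `I k = (x k, θ k)` as a random variable. -/
def overallState (π : ControlPolicy n m N) (x₀ : Fin n → ℝ) (k : ℕ) (ω : Ω) :
    (Fin n → ℝ) × Fin N :=
  (S.state π x₀ (fun l => θ l ω) k, θ k ω)

/-- The σ-algebra generated by `I k`. -/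
abbrev overallSigma (π : ControlPolicy n m N) (x₀ : Fin n → ℝ) (k : ℕ) : MeasurableSpace Ω :=
  MeasurableSpace.comap (S.overallState θ π x₀ k) inferInstance

/-- Conditional independence of `x (k+1)` and `θ (k+1)` given `I k`, under every control policy
and from every initial condition:
`E[f(x (k+1)) g(θ (k+1)) | I k] = E[f(x (k+1)) | I k] E[g(θ (k+1)) | I k]`. -/
def ConditionallyIndependent : Prop :=
  ∀ (π : ControlPolicy n m N) (x₀ : Fin n → ℝ) (i : Fin N) (k : ℕ)
    (f : (Fin n → ℝ) → ℝ) (g : Fin N → ℝ), Measurable f → (∃ c, ∀ x, |f x| ≤ c) →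
    (ℙ i)[fun ω => f (S.overallState θ π x₀ (k + 1) ω).1 *
        g (S.overallState θ π x₀ (k + 1) ω).2 | S.overallSigma θ π x₀ k]
      =ᵐ[ℙ i]
    fun ω =>
      ((ℙ i)[fun ω' => f (S.overallState θ π x₀ (k + 1) ω').1 | S.overallSigma θ π x₀ k]) ω *
      ((ℙ i)[fun ω' => g (S.overallState θ π x₀ (k + 1) ω').2 | S.overallSigma θ π x₀ k]) ω

/-- Mean-square stability of the system controlled by `π`: `∑ₖ E[‖x k‖² | I 0] < ∞` for every
initial condition, with the Euclidean norm. -/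
def MeanSquareStable (π : ControlPolicy n m N) : Prop :=
  ∀ (x₀ : Fin n → ℝ) (i : Fin N),
    ∑' k, ∫⁻ ω, ENNReal.ofReal (‖WithLp.toLp 2 (S.overallState θ π x₀ k ω).1‖ ^ 2) ∂(ℙ i) < ⊤

/-- Mean-square stabilizability by a mode-dependent linear feedback `u k = - K_{θ k} x k`. -/
def MeanSquareStabilizable : Prop :=
  ∃ K : Fin N → Matrix (Fin m) (Fin n) ℝ,
    S.MeanSquareStable ℙ θ (feedbackPolicy fun x i => -(K i).mulVec x)

/-- The infinite-horizon cost of the policy `π` given `I 0 = (x₀, i)`. -/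
def cost (π : ControlPolicy n m N) (x₀ : Fin n → ℝ) (i : Fin N) : ENNReal :=
  ∫⁻ ω, ∑' k, ENNReal.ofReal (S.stageCost (S.state π x₀ (fun l => θ l ω) k) (θ k ω)
    (S.input π x₀ (fun l => θ l ω) k)) ∂(ℙ i)

/-- The optimal value function `J*`: the infimum of the cost over all causal control policies. -/
def optimalValue (x₀ : Fin n → ℝ) (i : Fin N) : ENNReal :=
  ⨅ π : ControlPolicy n m N, S.cost ℙ θ π x₀ i

/-- `μ` is an optimal feedback: it attains the optimal value from every initial condition. -/
def IsOptimalFeedback (μ : (Fin n → ℝ) → Fin N → (Fin m → ℝ)) : Prop :=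
  ∀ x i, S.cost ℙ θ (feedbackPolicy μ) x i = S.optimalValue ℙ θ x i

/-- `xᵀ Q_i x + uᵀ R_i u + E[V(x⁺, θ⁺)]`, where `x⁺ = A_i x + B_i u` and `θ⁺` is the mode that
follows the mode `i`. By homogeneity of the chain the expectation is taken over the first step. -/
def qValue (V : (Fin n → ℝ) → Fin N → ℝ) (x : Fin n → ℝ) (i : Fin N) (u : Fin m → ℝ) : ℝ :=
  S.stageCost x i u + ∫ ω, V ((S.A i).mulVec x + (S.B i).mulVec u) (θ 1 ω) ∂(ℙ i)

/-- `μ x i ∈ argmin_u [xᵀ Q_i x + uᵀ R_i u + E[V(x⁺, θ⁺)]]` for all `x` and `i`. -/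
def IsGreedy (V : (Fin n → ℝ) → Fin N → ℝ) (μ : (Fin n → ℝ) → Fin N → (Fin m → ℝ)) : Prop :=
  ∀ x i u, S.qValue ℙ θ V x i (μ x i) ≤ S.qValue ℙ θ V x i u

/-- `J` and `u` are sequences of value functions and control laws generated by value iteration
from `J 0 = 0`. -/
structure IsValueIteration (J : ℕ → (Fin n → ℝ) → Fin N → ℝ)
    (u : ℕ → (Fin n → ℝ) → Fin N → (Fin m → ℝ)) : Prop where
  zero : ∀ x i, J 0 x i = 0
  greedy : ∀ j, S.IsGreedy ℙ θ (J j) (u j)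
  succ : ∀ j x i, J (j + 1) x i = S.qValue ℙ θ (J j) x i (u j x i)

/-- The HJB equation `V(x, i) = min_u [xᵀ Q_i x + uᵀ R_i u + E[V(x⁺, θ⁺)]]`; the minimum is
attained. -/
def SatisfiesHJB (V : (Fin n → ℝ) → Fin N → ℝ) : Prop :=
  ∀ x i, IsLeast (Set.range (S.qValue ℙ θ V x i)) (V x i)

/-- The Bellman equation for the feedback `μ`, for each value of the overall state and along each
closed-loop trajectory:
`V(x k, θ k) = (x k)ᵀ Q (x k) + (u k)ᵀ R (u k) + E[V(x (k+1), θ (k+1)) | I k]` almost surely,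
with `u k = μ (x k) (θ k)`. -/
def SatisfiesBellman (V : (Fin n → ℝ) → Fin N → ℝ)
    (μ : (Fin n → ℝ) → Fin N → (Fin m → ℝ)) : Prop :=
  (∀ x i, V x i = S.qValue ℙ θ V x i (μ x i)) ∧
  ∀ (x₀ : Fin n → ℝ) (i : Fin N) (k : ℕ),
    (fun ω => V (S.overallState θ (feedbackPolicy μ) x₀ k ω).1 (θ k ω)) =ᵐ[ℙ i]
    fun ω =>
      S.stageCost (S.overallState θ (feedbackPolicy μ) x₀ k ω).1 (θ k ω)
        (μ (S.overallState θ (feedbackPolicy μ) x₀ k ω).1 (θ k ω)) +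
      ((ℙ i)[fun ω' => V (S.overallState θ (feedbackPolicy μ) x₀ (k + 1) ω').1 (θ (k + 1) ω') |
        S.overallSigma θ (feedbackPolicy μ) x₀ k]) ω

end MJLS

/-- Ergodicity of the mode chain: from each mode `i`, each mode `j` is reached within a finite
number of steps with non-zero probability. -/
def ModeErgodic {N : ℕ} {Ω : Type*} [MeasurableSpace Ω] (ℙ : Fin N → Measure Ω)
    (θ : ℕ → Ω → Fin N) : Prop :=
  ∀ i j, ∃ k, 0 < ℙ i {ω | θ k ω = j}

end

/-! Dynamic programming squeezes the limit `V` of the iterates between two costs. With a fixed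
initial state, everything known at time `k` depends on finitely many modes, so measurability and
integrability are automatic, and the Markov property turns the expectation of `qValue` at time `k`
into the expected stage cost plus the expected value at time `k + 1` (`integral_qValue`).

Lower bound: iterating this, `J T` is at most the `T`-stage cost of any policy. The stabilizing
feedback has finite cost, so the increasing iterates converge and their limit is at most every cost.
Upper bound: a feedback attaining the minimum in the HJB equation telescopes to `V` minus a
nonnegative terminal term, so its cost is at most `V`.

Existence of minimizers needs no Riccati equation. Each iterate is convex, hence continuous on a
finite-dimensional space, and `R > 0` makes `qValue` coercive in the input. The same coercivity
confines the minimizers at a fixed state to a ball, and a cluster point attains the HJB minimum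
(`satisfiesHJB_of_tendsto`). -/

/-! ### Mode paths and the Markov property. -/

theorem DependsOn.exists_factor_fin {α β : Type*} {k : ℕ} {f : (ℕ → α) → β}
    (hf : DependsOn f (Set.Iic k)) :
    ∃ g : (Fin (k + 1) → α) → β, ∀ s, f s = g (fun l => s l) := by
  -- The path is frozen after time `k`, which needs no default element of `α`.
  refine ⟨fun h => f fun l => h ⟨min l k, by omega⟩, fun s => hf fun l hl => ?_⟩
  simp [min_eq_left (Set.mem_Iic.1 hl)]

theorem DependsOn.finite_range_comp {α β Ω : Type*} [Finite α] {k : ℕ} {f : (ℕ → α) → β}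
    (hf : DependsOn f (Set.Iic k)) (θ : ℕ → Ω → α) :
    (Set.range fun ω => f fun l => θ l ω).Finite := by
  obtain ⟨g, hg⟩ := hf.exists_factor_fin
  refine (Set.finite_range g).subset ?_
  rintro _ ⟨ω, rfl⟩
  exact ⟨_, (hg _).symm⟩

theorem ConvexOn.continuous_of_univ {n : ℕ} {f : (Fin n → ℝ) → ℝ}
    (hf : ConvexOn ℝ Set.univ f) : Continuous f :=
  continuousOn_univ.1 (hf.continuousOn isOpen_univ)

namespace IsModeChain

variable {N : ℕ} {p : Matrix (Fin N) (Fin N) ℝ} {Ω : Type*} [MeasurableSpace Ω]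
  {ℙ : Fin N → Measure Ω} {θ : ℕ → Ω → Fin N}

theorem measurable_of_dependsOn (h : IsModeChain p ℙ θ) {β : Type*} [MeasurableSpace β] {k : ℕ}
    {f : (ℕ → Fin N) → β} (hf : DependsOn f (Set.Iic k)) :
    Measurable fun ω => f fun l => θ l ω := by
  obtain ⟨g, hg⟩ := hf.exists_factor_fin
  simp only [hg]
  exact (measurable_of_finite g).comp (measurable_pi_lambda _ fun l => h.meas l)

theorem integrable_of_dependsOn (h : IsModeChain p ℙ θ) (i : Fin N) {k : ℕ}
    {f : (ℕ → Fin N) → ℝ} (hf : DependsOn f (Set.Iic k)) :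
    Integrable (fun ω => f fun l => θ l ω) (ℙ i) := by
  have := h.prob i
  obtain ⟨c, hc⟩ := ((hf.finite_range_comp θ).image norm).bddAbove
  refine Integrable.of_bound (h.measurable_of_dependsOn hf).aestronglyMeasurable c
    (Filter.Eventually.of_forall fun ω => hc ⟨_, ⟨ω, rfl⟩, rfl⟩)

theorem measureReal_path_succ (h : IsModeChain p ℙ θ) (hp : ∀ i j, 0 ≤ p i j) (i : Fin N) (k : ℕ)
    (a : Fin (k + 1) → Fin N) (j : Fin N) :
    (ℙ i).real {ω | (fun l : Fin (k + 1) => θ l ω) = a ∧ θ (k + 1) ω = j} =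
      (ℙ i).real {ω | (fun l : Fin (k + 1) => θ l ω) = a} * p (a (Fin.last k)) j := by
  -- The Markov axiom speaks of infinite paths; `a` is continued by the constant `j`, of which only
  -- the entry at `k + 1` matters.
  have key := h.markov i k (fun l => if hl : l < k + 1 then a ⟨l, hl⟩ else j)
  have e1 : {ω | ∀ l ≤ k, θ l ω = (fun l => if hl : l < k + 1 then a ⟨l, hl⟩ else j) l} =
      {ω | (fun l : Fin (k + 1) => θ l ω) = a} := by
    ext ω
    simp only [Set.mem_ofPred_eq, funext_iff, Fin.forall_iff]
    refine forall_congr' fun l => ⟨fun H hl => ?_, fun H hl => ?_⟩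
    · simpa [hl] using H (by omega)
    · simpa [Nat.lt_succ_of_le hl] using H (by omega)
  have e2 : {ω | ∀ l ≤ k + 1, θ l ω = (fun l => if hl : l < k + 1 then a ⟨l, hl⟩ else j) l} =
      {ω | (fun l : Fin (k + 1) => θ l ω) = a ∧ θ (k + 1) ω = j} := by
    ext ω
    have := Set.ext_iff.1 e1 ω
    simp only [Set.mem_ofPred_eq] at this ⊢
    rw [← this]
    constructor
    · intro H
      exact ⟨fun l hl => H l (by omega), by simpa using H (k + 1) le_rfl⟩
    · rintro ⟨H, H'⟩ l hl
      rcases Nat.lt_or_eq_of_le hl with hl | rfl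
      · exact H l (by omega)
      · simpa using H'
  rw [e1, e2] at key
  simp only [Measure.real, key, ENNReal.toReal_mul]
  simp [Fin.last, ENNReal.toReal_ofReal (hp _ _)]

/-- The one-step Markov property, for functions of the mode path up to time `k + 1`. -/
theorem integral_succ (h : IsModeChain p ℙ θ) (hp : ∀ i j, 0 ≤ p i j) (i : Fin N) {k : ℕ}
    {f : (ℕ → Fin N) → Fin N → ℝ} (hf : DependsOn f (Set.Iic k)) :
    ∫ ω, f (fun l => θ l ω) (θ (k + 1) ω) ∂(ℙ i) =
      ∫ ω, ∑ j, p (θ k ω) j * f (fun l => θ l ω) j ∂(ℙ i) := by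
  have := h.prob i
  obtain ⟨g, hg⟩ := hf.exists_factor_fin
  have hH : Measurable fun ω => (fun l : Fin (k + 1) => θ l ω) :=
    measurable_pi_lambda _ fun l => h.meas l
  have hH' : Measurable fun ω => ((fun l : Fin (k + 1) => θ l ω), θ (k + 1) ω) :=
    hH.prodMk (h.meas (k + 1))
  have := Measure.isProbabilityMeasure_map (μ := ℙ i) hH.aemeasurable
  have := Measure.isProbabilityMeasure_map (μ := ℙ i) hH'.aemeasurable
  simp only [hg]
  -- Under the law of the finite path both integrals become finite sums, compared term by term.
  have e1 := integral_map (μ := ℙ i) hH'.aemeasurable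
    (f := fun z : (Fin (k + 1) → Fin N) × Fin N => g z.1 z.2)
    (measurable_of_finite _).aestronglyMeasurable
  have e2 := integral_map (μ := ℙ i) hH.aemeasurable
    (f := fun z : (Fin (k + 1) → Fin N) => ∑ j, p (z (Fin.last k)) j * g z j)
    (measurable_of_finite _).aestronglyMeasurable
  simp only [Fin.val_last] at e2
  rw [← e1, ← e2, integral_fintype (Integrable.of_finite), integral_fintype (Integrable.of_finite),
    Fintype.sum_prod_type]
  refine Finset.sum_congr rfl fun a _ => ?_
  rw [smul_eq_mul, Finset.mul_sum]
  refine Finset.sum_congr rfl fun j _ => ?_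
  rw [map_measureReal_apply hH' (measurableSet_singleton _),
    map_measureReal_apply hH (measurableSet_singleton _), smul_eq_mul, ← mul_assoc]
  congr 1
  convert h.measureReal_path_succ hp i k a j using 2
  · ext ω
    simp
  · congr 1

theorem integral_one (h : IsModeChain p ℙ θ) (hp : ∀ i j, 0 ≤ p i j) (i : Fin N)
    (f : Fin N → ℝ) : ∫ ω, f (θ 1 ω) ∂(ℙ i) = ∑ j, p i j * f j := by
  have := h.prob i
  have := h.integral_succ hp i (k := 0) (f := fun _ => f) (fun _ _ _ => rfl)
  rw [zero_add] at this
  rw [this, integral_congr_ae (g := fun _ => ∑ j, p i j * f j)]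
  · simp
  · filter_upwards [h.init i] with ω hω
    rw [hω]

end IsModeChain

/-! ### Quadratic forms. -/

namespace Matrix

/-- The gap between the two sides is exactly `a * b` times the form at `x - y`. -/
theorem PosSemidef.dotProduct_mulVec_combo_le {n : ℕ} {M : Matrix (Fin n) (Fin n) ℝ}
    (hM : M.PosSemidef) (x y : Fin n → ℝ) {a b : ℝ} (ha : 0 ≤ a) (hb : 0 ≤ b) (hab : a + b = 1) :
    (a • x + b • y) ⬝ᵥ M.mulVec (a • x + b • y) ≤
      a * (x ⬝ᵥ M.mulVec x) + b * (y ⬝ᵥ M.mulVec y) := by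
  have h := hM.dotProduct_mulVec_nonneg (x - y)
  simp only [star_trivial, mulVec_sub, dotProduct_sub, sub_dotProduct] at h
  simp only [mulVec_add, mulVec_smul, dotProduct_add, add_dotProduct, smul_dotProduct,
    dotProduct_smul, smul_eq_mul]
  obtain rfl : b = 1 - a := by linarith
  nlinarith [mul_nonneg (mul_nonneg ha hb) h]

/-- The constant is the minimum of the form on the compact unit sphere, extended by homogeneity; the
sphere is empty when `m = 0`. -/
theorem PosDef.exists_mul_norm_sq_le {m : ℕ} {M : Matrix (Fin m) (Fin m) ℝ} (hM : M.PosDef) :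
    ∃ c > 0, ∀ u : Fin m → ℝ, c * ‖u‖ ^ 2 ≤ u ⬝ᵥ M.mulVec u := by
  rcases (Metric.sphere (0 : Fin m → ℝ) 1).eq_empty_or_nonempty with hS | hS
  · refine ⟨1, one_pos, fun u => ?_⟩
    by_cases hu : u = 0
    · simp [hu]
    · have : ‖u‖⁻¹ • u ∈ Metric.sphere (0 : Fin m → ℝ) 1 := by
        simp [norm_smul, hu]
      simp [hS] at this
  · obtain ⟨v, hv, hmin⟩ := (isCompact_sphere (0 : Fin m → ℝ) 1).exists_isMinOn hS
      (f := fun u => u ⬝ᵥ M.mulVec u) (by fun_prop)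
    have hv0 : v ≠ 0 := by
      rintro rfl
      simp at hv
    refine ⟨_, by simpa using hM.dotProduct_mulVec_pos hv0, fun u => ?_⟩
    by_cases hu : u = 0
    · simp [hu]
    have hu' : ‖u‖ ≠ 0 := by simpa using hu
    have : ‖u‖⁻¹ • u ∈ Metric.sphere (0 : Fin m → ℝ) 1 := by
      simp [norm_smul, hu]
    have h := hmin this
    simp only [Set.mem_ofPred_eq, mulVec_smul, smul_dotProduct, dotProduct_smul, smul_eq_mul] at h
    calc _ ≤ (‖u‖⁻¹ * (‖u‖⁻¹ * u ⬝ᵥ M *ᵥ u)) * ‖u‖ ^ 2 := by gcongr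
      _ = _ := by field_simp

/-- A quadratic form is bounded by a multiple of the squared Euclidean norm. -/
theorem exists_dotProduct_mulVec_le {n : ℕ} (M : Matrix (Fin n) (Fin n) ℝ) :
    ∃ c ≥ 0, ∀ x : Fin n → ℝ, x ⬝ᵥ M.mulVec x ≤ c * ‖WithLp.toLp 2 x‖ ^ 2 := by
  let T := Matrix.toEuclideanCLM (n := Fin n) (𝕜 := ℝ) M
  refine ⟨‖T‖, norm_nonneg _, fun x => ?_⟩
  have h1 : x ⬝ᵥ M.mulVec x = inner ℝ (T (WithLp.toLp 2 x)) (WithLp.toLp 2 x) := by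
    simp [T, EuclideanSpace.inner_eq_star_dotProduct]
  rw [h1]
  refine (real_inner_le_norm _ _).trans ?_
  rw [sq, ← mul_assoc]
  gcongr
  exact T.le_opNorm _

end Matrix

/-! ### Stage cost and dependence on the mode path. -/

namespace MJLS

variable {n m q N : ℕ} (S : MJLS n m q N)

theorem stageCost_nonneg (x : Fin n → ℝ) (i : Fin N) (u : Fin m → ℝ) : 0 ≤ S.stageCost x i u := by
  have h1 := (S.Q_posSemidef i).dotProduct_mulVec_nonneg x
  have h2 := (S.R_posDef i).posSemidef.dotProduct_mulVec_nonneg u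
  simp only [star_trivial] at h1 h2
  exact add_nonneg h1 h2

theorem stageCost_combo_le (i : Fin N) (x y : Fin n → ℝ) (u v : Fin m → ℝ) {a b : ℝ}
    (ha : 0 ≤ a) (hb : 0 ≤ b) (hab : a + b = 1) :
    S.stageCost (a • x + b • y) i (a • u + b • v) ≤
      a * S.stageCost x i u + b * S.stageCost y i v := by
  have h1 := (S.Q_posSemidef i).dotProduct_mulVec_combo_le x y ha hb hab
  have h2 := (S.R_posDef i).posSemidef.dotProduct_mulVec_combo_le u v ha hb hab
  simp only [stageCost]
  linarith

theorem exists_mul_norm_sq_le_stageCost (i : Fin N) :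
    ∃ c > 0, ∀ x u, c * ‖u‖ ^ 2 ≤ S.stageCost x i u := by
  obtain ⟨c, hc, h⟩ := (S.R_posDef i).exists_mul_norm_sq_le
  refine ⟨c, hc, fun x u => (h u).trans ?_⟩
  have h1 := (S.Q_posSemidef i).dotProduct_mulVec_nonneg x
  simp only [star_trivial] at h1
  exact le_add_of_nonneg_left h1

theorem exists_stageCost_linear_le (K : Fin N → Matrix (Fin m) (Fin n) ℝ) :
    ∃ c ≥ 0, ∀ x i, S.stageCost x i (-(K i).mulVec x) ≤ c * ‖WithLp.toLp 2 x‖ ^ 2 := by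
  choose c hc h using fun i =>
    Matrix.exists_dotProduct_mulVec_le (S.Q i + (K i).transpose * S.R i * K i)
  refine ⟨∑ i, c i, Finset.sum_nonneg fun i _ => hc i, fun x i => ?_⟩
  have e : S.stageCost x i (-(K i).mulVec x) =
      x ⬝ᵥ (S.Q i + (K i).transpose * S.R i * K i).mulVec x := by
    simp only [stageCost, Matrix.add_mulVec, dotProduct_add, Matrix.mulVec_neg, neg_dotProduct,
      dotProduct_neg, neg_neg, ← Matrix.mulVec_mulVec, add_right_inj]
    rw [Matrix.dotProduct_mulVec x, Matrix.vecMul_transpose]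
  rw [e]
  refine (h i x).trans ?_
  gcongr
  exact Finset.single_le_sum (fun i _ => hc i) (Finset.mem_univ i)

theorem history_dependsOn (π : ControlPolicy n m N) (x₀ : Fin n → ℝ) (k : ℕ) :
    DependsOn (fun s => S.history π x₀ s k) (Set.Iic k) := by
  induction k with
  | zero => intro s t h; simp [history, h 0]
  | succ k ih =>
    intro s t h
    have := ih fun l hl => h l (le_trans hl k.le_succ)
    simp only at this
    simp only [history, this, h k k.le_succ, h (k + 1) (Set.mem_Iic.2 le_rfl)]

theorem state_dependsOn (π : ControlPolicy n m N) (x₀ : Fin n → ℝ) (k : ℕ) :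
    DependsOn (fun s => S.state π x₀ s k) (Set.Iic k) := fun s t h => by
  have := S.history_dependsOn π x₀ k h
  simp only at this
  simp only [state, this]

theorem input_dependsOn (π : ControlPolicy n m N) (x₀ : Fin n → ℝ) (k : ℕ) :
    DependsOn (fun s => S.input π x₀ s k) (Set.Iic k) := fun s t h => by
  have := S.history_dependsOn π x₀ k h
  simp only at this
  simp only [input, this]

theorem dependsOn_state_input {β : Type*} (π : ControlPolicy n m N) (x₀ : Fin n → ℝ) (k : ℕ)
    (F : (Fin n → ℝ) → Fin N → (Fin m → ℝ) → β) :
    DependsOn (fun s => F (S.state π x₀ s k) (s k) (S.input π x₀ s k)) (Set.Iic k) :=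
  fun s t h => by
    have h1 := S.state_dependsOn π x₀ k h
    have h2 := S.input_dependsOn π x₀ k h
    simp only at h1 h2
    simp only [h1, h2, h k (Set.mem_Iic.2 le_rfl)]

/-- No measurability of `F` is needed: the overall state takes finitely many values, so a preimage
may be cut down to a finite, hence measurable, set. -/
theorem measurable_comp_overallState {Ω : Type*} (θ : ℕ → Ω → Fin N)
    (π : ControlPolicy n m N) (x₀ : Fin n → ℝ) (k : ℕ) {β : Type*} [MeasurableSpace β] (F : (Fin n → ℝ) × Fin N → β) :
    Measurable[S.overallSigma θ π x₀ k] fun ω => F (S.overallState θ π x₀ k ω) := by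
  intro T _
  have hfin : (Set.range (S.overallState θ π x₀ k)).Finite :=
    (S.dependsOn_state_input π x₀ k fun x i _ => (x, i)).finite_range_comp θ
  refine ⟨F ⁻¹' T ∩ Set.range (S.overallState θ π x₀ k),
    (hfin.subset Set.inter_subset_right).measurableSet, ?_⟩
  ext ω
  simp

/-! ### The one-step operator: monotonicity, convexity, minimizers. -/

variable {S} {Ω : Type*} [MeasurableSpace Ω] {ℙ : Fin N → Measure Ω} {θ : ℕ → Ω → Fin N}

theorem qValue_eq_sum (hchain : IsModeChain S.trans ℙ θ) (V : (Fin n → ℝ) → Fin N → ℝ)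
    (x : Fin n → ℝ) (i : Fin N) (u : Fin m → ℝ) :
    S.qValue ℙ θ V x i u =
      S.stageCost x i u + ∑ j, S.trans i j * V ((S.A i).mulVec x + (S.B i).mulVec u) j := by
  rw [qValue, hchain.integral_one S.trans_nonneg]

theorem qValue_mono (hchain : IsModeChain S.trans ℙ θ) {V W : (Fin n → ℝ) → Fin N → ℝ}
    (h : ∀ x i, V x i ≤ W x i) (x : Fin n → ℝ) (i : Fin N) (u : Fin m → ℝ) :
    S.qValue ℙ θ V x i u ≤ S.qValue ℙ θ W x i u := by
  rw [qValue_eq_sum hchain, qValue_eq_sum hchain]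
  gcongr with j
  · exact S.trans_nonneg i j
  · exact h _ _

theorem stageCost_le_qValue (hchain : IsModeChain S.trans ℙ θ) {V : (Fin n → ℝ) → Fin N → ℝ}
    (hV : ∀ x i, 0 ≤ V x i) (x : Fin n → ℝ) (i : Fin N) (u : Fin m → ℝ) :
    S.stageCost x i u ≤ S.qValue ℙ θ V x i u := by
  rw [qValue_eq_sum hchain]
  exact le_add_of_nonneg_right
    (Finset.sum_nonneg fun j _ => mul_nonneg (S.trans_nonneg i j) (hV _ _))

theorem tendsto_qValue (hchain : IsModeChain S.trans ℙ θ) {J : ℕ → (Fin n → ℝ) → Fin N → ℝ}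
    {V : (Fin n → ℝ) → Fin N → ℝ}
    (h : ∀ x i, Filter.Tendsto (fun j => J j x i) Filter.atTop (nhds (V x i)))
    (x : Fin n → ℝ) (i : Fin N) (u : Fin m → ℝ) :
    Filter.Tendsto (fun j => S.qValue ℙ θ (J j) x i u) Filter.atTop
      (nhds (S.qValue ℙ θ V x i u)) := by
  simp only [qValue_eq_sum hchain]
  exact tendsto_const_nhds.add (tendsto_finsetSum _ fun j _ => (h _ j).const_mul _)

theorem continuous_qValue (hchain : IsModeChain S.trans ℙ θ) {V : (Fin n → ℝ) → Fin N → ℝ}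
    (hV : ∀ i, Continuous fun x => V x i) (x : Fin n → ℝ) (i : Fin N) :
    Continuous fun u => S.qValue ℙ θ V x i u := by
  simp only [qValue_eq_sum hchain, stageCost]
  refine Continuous.add (by fun_prop) (continuous_finsetSum _ fun j _ => ?_)
  exact continuous_const.mul ((hV j).comp (by fun_prop))

/-- Convexity is joint in state and input, because the next state is linear in the pair; this is
what survives minimization over the input. -/
theorem qValue_combo_le (hchain : IsModeChain S.trans ℙ θ) {V : (Fin n → ℝ) → Fin N → ℝ}
    (hV : ∀ i, ConvexOn ℝ Set.univ fun x => V x i) (i : Fin N) (x y : Fin n → ℝ)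
    (u v : Fin m → ℝ) {a b : ℝ} (ha : 0 ≤ a) (hb : 0 ≤ b) (hab : a + b = 1) :
    S.qValue ℙ θ V (a • x + b • y) i (a • u + b • v) ≤
      a * S.qValue ℙ θ V x i u + b * S.qValue ℙ θ V y i v := by
  simp only [qValue_eq_sum hchain]
  have e : (S.A i).mulVec (a • x + b • y) + (S.B i).mulVec (a • u + b • v) =
      a • ((S.A i).mulVec x + (S.B i).mulVec u) + b • ((S.A i).mulVec y + (S.B i).mulVec v) := by
    simp only [Matrix.mulVec_add, Matrix.mulVec_smul, smul_add]
    abel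
  rw [e]
  have h1 := S.stageCost_combo_le i x y u v ha hb hab
  have h2 : ∑ j, S.trans i j * V (a • ((S.A i).mulVec x + (S.B i).mulVec u) +
        b • ((S.A i).mulVec y + (S.B i).mulVec v)) j ≤
      ∑ j, S.trans i j * (a * V ((S.A i).mulVec x + (S.B i).mulVec u) j +
        b * V ((S.A i).mulVec y + (S.B i).mulVec v) j) := by
    gcongr with j
    · exact S.trans_nonneg i j
    · exact (hV j).2 (Set.mem_univ _) (Set.mem_univ _) ha hb hab
  simp only [mul_add, mul_left_comm _ a, mul_left_comm _ b, Finset.sum_add_distrib,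
    ← Finset.mul_sum] at h2 ⊢
  linarith

theorem exists_isMinOn_qValue (hchain : IsModeChain S.trans ℙ θ) {V : (Fin n → ℝ) → Fin N → ℝ}
    (hV0 : ∀ x i, 0 ≤ V x i) (hV : ∀ i, Continuous fun x => V x i) (x : Fin n → ℝ) (i : Fin N) :
    ∃ u, ∀ v, S.qValue ℙ θ V x i u ≤ S.qValue ℙ θ V x i v := by
  obtain ⟨c, hc, h⟩ := S.exists_mul_norm_sq_le_stageCost i
  refine (continuous_qValue hchain hV x i).exists_forall_le ?_
  refine Filter.tendsto_atTop_mono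
    (fun u => (h x u).trans (stageCost_le_qValue hchain hV0 x i u)) ?_
  exact ((Filter.tendsto_pow_atTop two_ne_zero).comp
    (tendsto_norm_cocompact_atTop (E := Fin m → ℝ))).const_mul_atTop hc

/-- Partial minimization preserves joint convexity: the minimizer at `a • x + b • y` does no worse
than the same combination of the minimizers at `x` and `y`. -/
theorem convexOn_qValue_of_isGreedy (hchain : IsModeChain S.trans ℙ θ)
    {V : (Fin n → ℝ) → Fin N → ℝ} {μ : (Fin n → ℝ) → Fin N → (Fin m → ℝ)}
    (hV : ∀ i, ConvexOn ℝ Set.univ fun x => V x i) (hμ : S.IsGreedy ℙ θ V μ) (i : Fin N) :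
    ConvexOn ℝ Set.univ fun x => S.qValue ℙ θ V x i (μ x i) :=
  ⟨convex_univ, fun x _ y _ _ _ ha hb hab =>
    (hμ _ _ _).trans (qValue_combo_le hchain hV i x y (μ x i) (μ y i) ha hb hab)⟩

theorem exists_isGreedy (hchain : IsModeChain S.trans ℙ θ) {V : (Fin n → ℝ) → Fin N → ℝ}
    (hV0 : ∀ x i, 0 ≤ V x i) (hV : ∀ i, Continuous fun x => V x i) :
    ∃ μ, S.IsGreedy ℙ θ V μ := by
  choose μ hμ using exists_isMinOn_qValue hchain hV0 hV
  exact ⟨μ, hμ⟩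

theorem exists_isValueIteration (hchain : IsModeChain S.trans ℙ θ) :
    ∃ J u, S.IsValueIteration ℙ θ J u := by
  -- The recursion carries nonnegativity and convexity along, since they guarantee the next
  -- minimizer.
  let X := {V : (Fin n → ℝ) → Fin N → ℝ //
    (∀ x i, 0 ≤ V x i) ∧ ∀ i, ConvexOn ℝ Set.univ fun x => V x i}
  have hg (V : X) : ∃ μ, S.IsGreedy ℙ θ V.1 μ :=
    exists_isGreedy hchain V.2.1 fun i => (V.2.2 i).continuous_of_univ
  choose μ hμ using hg
  let step (V : X) : X := ⟨fun x i => S.qValue ℙ θ V.1 x i (μ V x i),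
    fun x i => (S.stageCost_nonneg _ _ _).trans (stageCost_le_qValue hchain V.2.1 _ _ _),
    convexOn_qValue_of_isGreedy hchain V.2.2 (hμ V)⟩
  let J (j : ℕ) : X := Nat.rec ⟨fun _ _ => 0, fun _ _ => le_rfl,
    fun _ => convexOn_const 0 convex_univ⟩ (fun _ V => step V) j
  exact ⟨fun j => (J j).1, fun j => μ (J j), fun _ _ => rfl, fun j => hμ (J j), fun _ _ _ => rfl⟩

/-! ### Value iterates and the HJB equation of their limit. -/

namespace IsValueIteration

variable {J : ℕ → (Fin n → ℝ) → Fin N → ℝ} {u : ℕ → (Fin n → ℝ) → Fin N → (Fin m → ℝ)}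

theorem nonneg (hJ : S.IsValueIteration ℙ θ J u) (hchain : IsModeChain S.trans ℙ θ) (j : ℕ)
    (x : Fin n → ℝ) (i : Fin N) : 0 ≤ J j x i := by
  induction j generalizing x i with
  | zero => exact (hJ.zero x i).ge
  | succ j ih =>
    rw [hJ.succ]
    exact (S.stageCost_nonneg _ _ _).trans (stageCost_le_qValue hchain ih _ _ _)

theorem succ_le_qValue (hJ : S.IsValueIteration ℙ θ J u) (j : ℕ) (x : Fin n → ℝ) (i : Fin N)
    (v : Fin m → ℝ) : J (j + 1) x i ≤ S.qValue ℙ θ (J j) x i v :=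
  hJ.succ j x i ▸ hJ.greedy j x i v

theorem monotone (hJ : S.IsValueIteration ℙ θ J u) (hchain : IsModeChain S.trans ℙ θ)
    (x : Fin n → ℝ) (i : Fin N) : Monotone fun j => J j x i := by
  have key (j : ℕ) : ∀ x i, J j x i ≤ J (j + 1) x i := by
    induction j with
    | zero => exact fun x i => (hJ.zero x i).le.trans (hJ.nonneg hchain 1 x i)
    | succ j ih =>
      intro x i
      rw [hJ.succ (j + 1)]
      exact (hJ.succ_le_qValue j x i _).trans (qValue_mono hchain ih _ _ _)
  exact monotone_nat_of_le_succ fun j => key j x i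

theorem convexOn (hJ : S.IsValueIteration ℙ θ J u) (hchain : IsModeChain S.trans ℙ θ) (j : ℕ)
    (i : Fin N) : ConvexOn ℝ Set.univ fun x => J j x i := by
  induction j generalizing i with
  | zero => simpa only [hJ.zero] using convexOn_const 0 convex_univ
  | succ j ih =>
    simp only [hJ.succ]
    exact convexOn_qValue_of_isGreedy hchain ih (hJ.greedy j) i

theorem continuous (hJ : S.IsValueIteration ℙ θ J u) (hchain : IsModeChain S.trans ℙ θ) (j : ℕ)
    (i : Fin N) : Continuous fun x => J j x i :=
  (hJ.convexOn hchain j i).continuous_of_univ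

/-- One inequality is the limit of `succ_le_qValue`. For attainment, limit and minimum are exchanged
by compactness of the minimizers and monotonicity of the iterates. -/
theorem satisfiesHJB_of_tendsto (hJ : S.IsValueIteration ℙ θ J u)
    (hchain : IsModeChain S.trans ℙ θ) {V : (Fin n → ℝ) → Fin N → ℝ}
    (hV : ∀ x i, Filter.Tendsto (fun j => J j x i) Filter.atTop (nhds (V x i))) :
    S.SatisfiesHJB ℙ θ V := by
  intro x i
  have hle (j : ℕ) (x : Fin n → ℝ) (i : Fin N) : J j x i ≤ V x i :=
    (hJ.monotone hchain x i).ge_of_tendsto (hV x i) j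
  have hlower (v : Fin m → ℝ) : V x i ≤ S.qValue ℙ θ V x i v :=
    le_of_tendsto_of_tendsto ((hV x i).comp (Filter.tendsto_add_atTop_nat 1))
      (tendsto_qValue hchain hV x i v)
      (Filter.Eventually.of_forall fun j => hJ.succ_le_qValue j x i v)
  obtain ⟨c, hc, hcb⟩ := S.exists_mul_norm_sq_le_stageCost i
  -- The radius comes from `c * ‖u j x i‖ ^ 2 ≤ J (j + 1) x i ≤ V x i`.
  have hmem (j : ℕ) : u j x i ∈ Metric.closedBall (0 : Fin m → ℝ) (√(V x i / c)) := by
    rw [mem_closedBall_zero_iff]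
    refine Real.le_sqrt_of_sq_le ((le_div_iff₀' hc).2 ?_)
    refine (hcb x _).trans ((stageCost_le_qValue hchain (hJ.nonneg hchain j) x i _).trans ?_)
    rw [← hJ.succ]
    exact hle _ _ _
  obtain ⟨v, -, φ, hφ, hlim⟩ := (isCompact_closedBall (0 : Fin m → ℝ) _).tendsto_subseq hmem
  have hupper : S.qValue ℙ θ V x i v ≤ V x i := by
    -- With `k` fixed, `J k` is continuous and lies below `J (φ l)` for `l ≥ k`; the limit is taken
    -- first in `l`, then in `k`.
    refine le_of_tendsto' (tendsto_qValue hchain hV x i v) fun k => ?_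
    refine le_of_tendsto
      (((continuous_qValue hchain (hJ.continuous hchain k) x i).tendsto v).comp hlim) ?_
    filter_upwards [Filter.eventually_ge_atTop k] with l hl
    refine (qValue_mono hchain (fun x i => hJ.monotone hchain x i
      (hl.trans (hφ.le_apply))) x i _).trans ?_
    exact (hJ.succ (φ l) x i).ge.trans (hle _ _ _)
  refine ⟨⟨v, le_antisymm hupper (hlower v)⟩, ?_⟩
  rintro _ ⟨w, rfl⟩
  exact hlower w

end IsValueIteration

end MJLS

/-! ### Expected costs of policies. -/

namespace MJLS

variable {n m q N : ℕ} {S : MJLS n m q N} {Ω : Type*} [MeasurableSpace Ω]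
  {ℙ : Fin N → Measure Ω} {θ : ℕ → Ω → Fin N}

theorem integrable_comp_state_input (hchain : IsModeChain S.trans ℙ θ) (π : ControlPolicy n m N)
    (x₀ : Fin n → ℝ) (i : Fin N) (k : ℕ) (F : (Fin n → ℝ) → Fin N → (Fin m → ℝ) → ℝ) :
    Integrable (fun ω => F (S.state π x₀ (fun l => θ l ω) k) (θ k ω)
      (S.input π x₀ (fun l => θ l ω) k)) (ℙ i) :=
  hchain.integrable_of_dependsOn i (S.dependsOn_state_input π x₀ k F)

/-- The expected cost of stage `k`, given `I 0 = (x₀, i)`. -/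
noncomputable def expectedStageCost (S : MJLS n m q N) (ℙ : Fin N → Measure Ω)
    (θ : ℕ → Ω → Fin N) (π : ControlPolicy n m N) (x₀ : Fin n → ℝ) (i : Fin N) (k : ℕ) : ℝ :=
  ∫ ω, S.stageCost (S.state π x₀ (fun l => θ l ω) k) (θ k ω)
    (S.input π x₀ (fun l => θ l ω) k) ∂(ℙ i)

theorem expectedStageCost_nonneg (π : ControlPolicy n m N) (x₀ : Fin n → ℝ) (i : Fin N) (k : ℕ) :
    0 ≤ S.expectedStageCost ℙ θ π x₀ i k :=
  integral_nonneg fun _ => S.stageCost_nonneg _ _ _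

theorem cost_eq_tsum (hchain : IsModeChain S.trans ℙ θ) (π : ControlPolicy n m N)
    (x₀ : Fin n → ℝ) (i : Fin N) :
    S.cost ℙ θ π x₀ i = ∑' k, ENNReal.ofReal (S.expectedStageCost ℙ θ π x₀ i k) := by
  have hint := fun k => integrable_comp_state_input hchain π x₀ i k S.stageCost
  rw [cost, lintegral_tsum fun k => (hint k).aemeasurable.ennreal_ofReal]
  refine tsum_congr fun k => ?_
  rw [expectedStageCost, ofReal_integral_eq_lintegral_ofReal (hint k)
    (Filter.Eventually.of_forall fun _ => S.stageCost_nonneg _ _ _)]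

theorem ofReal_sum_expectedStageCost_le_cost (hchain : IsModeChain S.trans ℙ θ)
    (π : ControlPolicy n m N) (x₀ : Fin n → ℝ) (i : Fin N) (T : ℕ) :
    ENNReal.ofReal (∑ k ∈ Finset.range T, S.expectedStageCost ℙ θ π x₀ i k) ≤
      S.cost ℙ θ π x₀ i := by
  rw [cost_eq_tsum hchain,
    ENNReal.ofReal_sum_of_nonneg fun k _ => expectedStageCost_nonneg π x₀ i k]
  exact ENNReal.sum_le_tsum _

theorem cost_le_ofReal (hchain : IsModeChain S.trans ℙ θ)
    (π : ControlPolicy n m N) (x₀ : Fin n → ℝ) (i : Fin N) {C : ℝ}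
    (h : ∀ T, ∑ k ∈ Finset.range T, S.expectedStageCost ℙ θ π x₀ i k ≤ C) :
    S.cost ℙ θ π x₀ i ≤ ENNReal.ofReal C := by
  rw [cost_eq_tsum hchain]
  refine ENNReal.tsum_le_of_sum_range_le fun T => ?_
  rw [← ENNReal.ofReal_sum_of_nonneg fun k _ => expectedStageCost_nonneg π x₀ i k]
  exact ENNReal.ofReal_le_ofReal (h T)

/-- Conditioning on the first `k` modes turns the value of the next state into a `qValue`. -/
theorem integral_qValue (hchain : IsModeChain S.trans ℙ θ) (π : ControlPolicy n m N)
    (x₀ : Fin n → ℝ) (i : Fin N) (k : ℕ) (V : (Fin n → ℝ) → Fin N → ℝ) :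
    ∫ ω, S.qValue ℙ θ V (S.state π x₀ (fun l => θ l ω) k) (θ k ω)
        (S.input π x₀ (fun l => θ l ω) k) ∂(ℙ i) =
      S.expectedStageCost ℙ θ π x₀ i k +
        ∫ ω, V (S.state π x₀ (fun l => θ l ω) (k + 1)) (θ (k + 1) ω) ∂(ℙ i) := by
  simp only [qValue_eq_sum hchain, expectedStageCost, state_succ]
  rw [integral_add (integrable_comp_state_input hchain π x₀ i k S.stageCost)
    (integrable_comp_state_input hchain π x₀ i k fun x i u =>
      ∑ j, S.trans i j * V ((S.A i).mulVec x + (S.B i).mulVec u) j)]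
  congr 1
  exact (hchain.integral_succ S.trans_nonneg i
    (S.dependsOn_state_input π x₀ k fun x i u j =>
      V ((S.A i).mulVec x + (S.B i).mulVec u) j)).symm

theorem integral_init (hchain : IsModeChain S.trans ℙ θ) (π : ControlPolicy n m N)
    (x₀ : Fin n → ℝ) (i : Fin N) (V : (Fin n → ℝ) → Fin N → ℝ) :
    ∫ ω, V (S.state π x₀ (fun l => θ l ω) 0) (θ 0 ω) ∂(ℙ i) = V x₀ i := by
  have := hchain.prob i
  rw [integral_congr_ae (g := fun _ => V x₀ i)]
  · simp
  · filter_upwards [hchain.init i] with ω hω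
    rw [state_zero, hω]

namespace IsValueIteration

variable {J : ℕ → (Fin n → ℝ) → Fin N → ℝ} {u : ℕ → (Fin n → ℝ) → Fin N → (Fin m → ℝ)}

/-- Over `T` stages, no policy does better in expectation than the value iterate `J T`. -/
theorem integral_le_sum (hJ : S.IsValueIteration ℙ θ J u) (hchain : IsModeChain S.trans ℙ θ)
    (π : ControlPolicy n m N) (x₀ : Fin n → ℝ) (i : Fin N) (T s : ℕ) :
    ∫ ω, J T (S.state π x₀ (fun l => θ l ω) s) (θ s ω) ∂(ℙ i) ≤
      ∑ k ∈ Finset.range T, S.expectedStageCost ℙ θ π x₀ i (s + k) := by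
  induction T generalizing s with
  | zero => simp [hJ.zero]
  | succ T ih =>
    -- The first stage is split off, leaving `T` stages that start at time `s + 1`; hence the
    -- induction over all `s`.
    rw [Finset.sum_range_succ', add_comm (Finset.sum _ _)]
    refine (integral_mono (integrable_comp_state_input hchain π x₀ i s fun x i _ => J (T + 1) x i)
      (integrable_comp_state_input hchain π x₀ i s (S.qValue ℙ θ (J T)))
      fun ω => hJ.succ_le_qValue T _ _ _).trans ?_
    rw [integral_qValue hchain]
    gcongr
    · rfl
    · simpa only [add_assoc, add_comm 1] using ih (s + 1)

theorem ofReal_le_cost (hJ : S.IsValueIteration ℙ θ J u) (hchain : IsModeChain S.trans ℙ θ)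
    (π : ControlPolicy n m N) (x : Fin n → ℝ) (i : Fin N) (T : ℕ) :
    ENNReal.ofReal (J T x i) ≤ S.cost ℙ θ π x i := by
  refine le_trans (ENNReal.ofReal_le_ofReal ?_)
    (ofReal_sum_expectedStageCost_le_cost hchain π x i T)
  have := hJ.integral_le_sum hchain π x i T 0
  simpa only [integral_init hchain π x i (J T), zero_add] using this

/-- The first input is kept as given and only the following `T` stages are bounded below by `J T`.
As `T` grows, this forces an optimal feedback to be greedy. -/
theorem ofReal_qValue_le_cost_feedback (hJ : S.IsValueIteration ℙ θ J u)
    (hchain : IsModeChain S.trans ℙ θ) (μ : (Fin n → ℝ) → Fin N → (Fin m → ℝ))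
    (x : Fin n → ℝ) (i : Fin N) (T : ℕ) :
    ENNReal.ofReal (S.qValue ℙ θ (J T) x i (μ x i)) ≤ S.cost ℙ θ (feedbackPolicy μ) x i := by
  refine le_trans (ENNReal.ofReal_le_ofReal ?_)
    (ofReal_sum_expectedStageCost_le_cost hchain (feedbackPolicy μ) x i (T + 1))
  have h1 := integral_qValue hchain (feedbackPolicy μ) x i 0 (J T)
  simp only [input_feedback] at h1
  rw [integral_init hchain (feedbackPolicy μ) x i fun x i => S.qValue ℙ θ (J T) x i (μ x i)] at h1
  rw [h1, Finset.sum_range_succ', add_comm]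
  gcongr
  simpa only [zero_add, add_comm 1] using hJ.integral_le_sum hchain (feedbackPolicy μ) x i T 1

end IsValueIteration

/-- Under linear feedback the stage cost is at most a constant times the squared norm of the state,
which is summable in expectation. -/
theorem exists_cost_lt_top (hchain : IsModeChain S.trans ℙ θ)
    (hstab : S.MeanSquareStabilizable ℙ θ) :
    ∃ π, ∀ x i, S.cost ℙ θ π x i < ⊤ := by
  obtain ⟨K, hK⟩ := hstab
  refine ⟨feedbackPolicy fun x i => -(K i).mulVec x, fun x i => ?_⟩
  obtain ⟨c, hc, hcb⟩ := S.exists_stageCost_linear_le K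
  have hle : S.cost ℙ θ (feedbackPolicy fun x i => -(K i).mulVec x) x i ≤
      ENNReal.ofReal c * ∑' k, ∫⁻ ω, ENNReal.ofReal (‖WithLp.toLp 2 (S.overallState θ
        (feedbackPolicy fun x i => -(K i).mulVec x) x k ω).1‖ ^ 2) ∂(ℙ i) := by
    rw [cost, lintegral_tsum fun k =>
      (integrable_comp_state_input hchain _ x i k S.stageCost).aemeasurable.ennreal_ofReal,
      ← ENNReal.tsum_mul_left]
    refine ENNReal.tsum_le_tsum fun k => ?_
    rw [← lintegral_const_mul' _ _ ENNReal.ofReal_ne_top]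
    refine lintegral_mono fun ω => ?_
    rw [← ENNReal.ofReal_mul hc, input_feedback]
    exact ENNReal.ofReal_le_ofReal (hcb _ _)
  exact hle.trans_lt (ENNReal.mul_lt_top ENNReal.ofReal_lt_top (hK x i))

/-- A feedback that attains `V` in the HJB equation has cost at most `V`, for `V ≥ 0`. -/
theorem cost_feedback_le (hchain : IsModeChain S.trans ℙ θ) {V : (Fin n → ℝ) → Fin N → ℝ}
    (hV0 : ∀ x i, 0 ≤ V x i) {μ : (Fin n → ℝ) → Fin N → (Fin m → ℝ)}
    (hμ : ∀ x i, S.qValue ℙ θ V x i (μ x i) = V x i) (x : Fin n → ℝ) (i : Fin N) :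
    S.cost ℙ θ (feedbackPolicy μ) x i ≤ ENNReal.ofReal (V x i) := by
  refine cost_le_ofReal hchain _ x i fun T => ?_
  -- Telescoping is exact; since `V` is nonnegative the terminal term can be dropped, without
  -- showing that it vanishes in the limit.
  have key : ∑ k ∈ Finset.range T, S.expectedStageCost ℙ θ (feedbackPolicy μ) x i k +
      ∫ ω, V (S.state (feedbackPolicy μ) x (fun l => θ l ω) T) (θ T ω) ∂(ℙ i) = V x i := by
    induction T with
    | zero => simpa using integral_init hchain (feedbackPolicy μ) x i V
    | succ T ih =>
      have := integral_qValue hchain (feedbackPolicy μ) x i T V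
      simp only [input_feedback, hμ] at this
      rw [Finset.sum_range_succ, add_assoc, ← this, ih]
  rw [← key]
  exact le_add_of_nonneg_right (integral_nonneg fun ω => hV0 _ _)

/-! ### Conditional expectations and the Bellman equation. -/

theorem overallSigma_le (hchain : IsModeChain S.trans ℙ θ) (π : ControlPolicy n m N)
    (x₀ : Fin n → ℝ) (k : ℕ) : S.overallSigma θ π x₀ k ≤ ‹MeasurableSpace Ω› :=
  Measurable.comap_le
    (hchain.measurable_of_dependsOn (S.dependsOn_state_input π x₀ k fun x i _ => (x, i)))

/-- The conditional expectation of the next value given `I k`, under a feedback. -/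
theorem condExp_overallState_succ (hchain : IsModeChain S.trans ℙ θ)
    (μ : (Fin n → ℝ) → Fin N → (Fin m → ℝ)) (V : (Fin n → ℝ) → Fin N → ℝ)
    (x₀ : Fin n → ℝ) (i : Fin N) (k : ℕ) :
    (ℙ i)[fun ω => V (S.overallState θ (feedbackPolicy μ) x₀ (k + 1) ω).1 (θ (k + 1) ω) |
        S.overallSigma θ (feedbackPolicy μ) x₀ k] =ᵐ[ℙ i]
      fun ω => ∑ j, S.trans (θ k ω) j *
        V ((S.A (θ k ω)).mulVec (S.overallState θ (feedbackPolicy μ) x₀ k ω).1 +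
          (S.B (θ k ω)).mulVec (μ (S.overallState θ (feedbackPolicy μ) x₀ k ω).1 (θ k ω))) j := by
  have := hchain.prob i
  have hm := overallSigma_le hchain (feedbackPolicy μ) x₀ k
  have hint := integrable_comp_state_input hchain (feedbackPolicy μ) x₀ i k fun x i _ =>
    ∑ j, S.trans i j * V ((S.A i).mulVec x + (S.B i).mulVec (μ x i)) j
  symm
  refine ae_eq_condExp_of_forall_setIntegral_eq hm
    (integrable_comp_state_input hchain (feedbackPolicy μ) x₀ i (k + 1) fun x i _ => V x i)
    (fun s _ _ => hint.integrableOn) ?_ ?_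
  · rintro _ ⟨T, hT, rfl⟩ -
    have hs := hm _ ⟨T, hT, rfl⟩
    rw [← integral_indicator hs, ← integral_indicator hs]
    classical
    -- An event known from the overall state has the form "it lies in `T`"; its indicator is
    -- absorbed into the function of the path, so the unconditional Markov identity suffices.
    have key := hchain.integral_succ S.trans_nonneg i
      (S.dependsOn_state_input (feedbackPolicy μ) x₀ k fun x i _ j =>
        if (x, i) ∈ T then V ((S.A i).mulVec x + (S.B i).mulVec (μ x i)) j else 0)
    convert key.symm using 2
    · ext ω
      by_cases h : S.overallState θ (feedbackPolicy μ) x₀ k ω ∈ T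
      · have h' : (S.state (feedbackPolicy μ) x₀ (fun l => θ l ω) k, θ k ω) ∈ T := h
        simp [Set.indicator, h', overallState]
      · have h' : (S.state (feedbackPolicy μ) x₀ (fun l => θ l ω) k, θ k ω) ∉ T := h
        simp [Set.indicator, h, h']
    · ext ω
      by_cases h : S.overallState θ (feedbackPolicy μ) x₀ k ω ∈ T
      · have h' : (S.state (feedbackPolicy μ) x₀ (fun l => θ l ω) k, θ k ω) ∈ T := h
        simp [Set.indicator, h', overallState, state_succ, input_feedback]
      · have h' : (S.state (feedbackPolicy μ) x₀ (fun l => θ l ω) k, θ k ω) ∉ T := h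
        simp [Set.indicator, h, h']
  · exact (S.measurable_comp_overallState θ (feedbackPolicy μ) x₀ k fun z =>
      ∑ j, S.trans z.2 j * V ((S.A z.2).mulVec z.1 + (S.B z.2).mulVec (μ z.1 z.2)) j
      ).stronglyMeasurable.aestronglyMeasurable

theorem satisfiesBellman_of_forall_eq (hchain : IsModeChain S.trans ℙ θ)
    {V : (Fin n → ℝ) → Fin N → ℝ} {μ : (Fin n → ℝ) → Fin N → (Fin m → ℝ)}
    (h : ∀ x i, V x i = S.qValue ℙ θ V x i (μ x i)) : S.SatisfiesBellman ℙ θ V μ := by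
  refine ⟨h, fun x₀ i k => ?_⟩
  filter_upwards [condExp_overallState_succ hchain μ V x₀ i k] with ω hω
  rw [hω, h, qValue_eq_sum hchain]

end MJLS

/-! ### The main theorem. -/

theorem theorem2 {n m q N : ℕ} (S : MJLS n m q N)
    {Ω : Type*} [MeasurableSpace Ω] (ℙ : Fin N → Measure Ω) (θ : ℕ → Ω → Fin N)
    (hchain : IsModeChain S.trans ℙ θ)
    (hindep : S.ConditionallyIndependent ℙ θ)
    (hergodic : ModeErgodic ℙ θ)
    (hstab : S.MeanSquareStabilizable ℙ θ) :
    (∃ J u, S.IsValueIteration ℙ θ J u) ∧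
    ∀ J u, S.IsValueIteration ℙ θ J u →
      (∀ x i, (∀ j, 0 ≤ J j x i) ∧ Monotone (fun j => J j x i) ∧
        BddAbove (Set.range fun j => J j x i)) ∧
      ∃ Jinf : (Fin n → ℝ) → Fin N → ℝ,
        (∀ x i, Filter.Tendsto (fun j => J j x i) Filter.atTop (nhds (Jinf x i))) ∧
        (∀ x i, S.optimalValue ℙ θ x i = ENNReal.ofReal (Jinf x i)) ∧
        S.SatisfiesHJB ℙ θ Jinf ∧
        (∃ μ, S.IsOptimalFeedback ℙ θ μ) ∧
        ∀ μ, (S.IsOptimalFeedback ℙ θ μ ↔ S.IsGreedy ℙ θ Jinf μ) ∧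
          (S.IsOptimalFeedback ℙ θ μ → S.SatisfiesBellman ℙ θ Jinf μ) := by
  refine ⟨MJLS.exists_isValueIteration hchain, fun J u hJ => ?_⟩
  have hbdd (x : Fin n → ℝ) (i : Fin N) : BddAbove (Set.range fun j => J j x i) := by
    obtain ⟨π, hπ⟩ := MJLS.exists_cost_lt_top hchain hstab
    refine ⟨(S.cost ℙ θ π x i).toReal, ?_⟩
    rintro _ ⟨j, rfl⟩
    exact (ENNReal.ofReal_le_iff_le_toReal (hπ x i).ne).1 (hJ.ofReal_le_cost hchain π x i j)
  obtain ⟨V, htend⟩ : ∃ V : (Fin n → ℝ) → Fin N → ℝ,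
      ∀ x i, Filter.Tendsto (fun j => J j x i) Filter.atTop (nhds (V x i)) :=
    ⟨_, fun x i => tendsto_atTop_ciSup (hJ.monotone hchain x i) (hbdd x i)⟩
  refine ⟨fun x i => ⟨fun j => hJ.nonneg hchain j x i, hJ.monotone hchain x i, hbdd x i⟩, V, ?_⟩
  have hHJB := hJ.satisfiesHJB_of_tendsto hchain htend
  have hV0 (x : Fin n → ℝ) (i : Fin N) : 0 ≤ V x i :=
    ge_of_tendsto' (htend x i) fun j => hJ.nonneg hchain j x i
  have hgreedy (μ : (Fin n → ℝ) → Fin N → (Fin m → ℝ)) :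
      S.IsGreedy ℙ θ V μ ↔ ∀ x i, S.qValue ℙ θ V x i (μ x i) = V x i := by
    refine forall₂_congr fun x i => ⟨fun h => ?_, fun h v => h ▸ (hHJB x i).2 ⟨v, rfl⟩⟩
    obtain ⟨v, hv⟩ := (hHJB x i).1
    exact le_antisymm (hv ▸ h v) ((hHJB x i).2 ⟨_, rfl⟩)
  have hlower (x : Fin n → ℝ) (i : Fin N) :
      ENNReal.ofReal (V x i) ≤ S.optimalValue ℙ θ x i :=
    le_iInf fun π => le_of_tendsto' (ENNReal.tendsto_ofReal (htend x i))
      fun j => hJ.ofReal_le_cost hchain π x i j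
  have hcost {μ : (Fin n → ℝ) → Fin N → (Fin m → ℝ)} (hμ : S.IsGreedy ℙ θ V μ)
      (x : Fin n → ℝ) (i : Fin N) :
      S.cost ℙ θ (feedbackPolicy μ) x i ≤ ENNReal.ofReal (V x i) :=
    MJLS.cost_feedback_le hchain hV0 ((hgreedy μ).1 hμ) x i
  obtain ⟨μ₀, hμ₀⟩ : ∃ μ, S.IsGreedy ℙ θ V μ := by
    choose μ hμ using fun x i => (hHJB x i).1
    exact ⟨μ, (hgreedy μ).2 hμ⟩
  have hopt (x : Fin n → ℝ) (i : Fin N) :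
      S.optimalValue ℙ θ x i = ENNReal.ofReal (V x i) :=
    le_antisymm ((iInf_le _ _).trans (hcost hμ₀ x i)) (hlower x i)
  have hiff (μ : (Fin n → ℝ) → Fin N → (Fin m → ℝ)) :
      S.IsOptimalFeedback ℙ θ μ ↔ S.IsGreedy ℙ θ V μ := by
    refine ⟨fun h => (hgreedy μ).2 fun x i => le_antisymm ?_ ((hHJB x i).2 ⟨_, rfl⟩),
      fun h x i => le_antisymm (hopt x i ▸ hcost h x i) (iInf_le _ _)⟩
    -- Optimality turns `V x i` into the cost of `μ`, which dominates `qValue` of every `J T` at `μ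
    -- x i`, hence that of the limit.
    rw [← ENNReal.ofReal_le_ofReal_iff (hV0 x i), ← hopt, ← h x i]
    exact le_of_tendsto' (ENNReal.tendsto_ofReal (MJLS.tendsto_qValue hchain htend x i _))
      fun j => hJ.ofReal_qValue_le_cost_feedback hchain μ x i j
  exact ⟨htend, hopt, hHJB, ⟨μ₀, (hiff μ₀).2 hμ₀⟩, fun μ => ⟨hiff μ, fun h =>
    MJLS.satisfiesBellman_of_forall_eq hchain fun x i =>
      ((hgreedy μ).1 ((hiff μ).1 h) x i).symm⟩⟩
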